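/- Consider the hat-guessing game with two hat colours and players $1,2,3,\dots$. Let $\nu$ denote the coin-flipping (fair product) measure. A \emph{strategy} is a sequence of functions $f_i:\{0,1\}^{\mathbb N\setminus\{i\}}\to\{0,1\}$, $i\ge 1$; it is \emph{measurable} if each $f_i$ is measurable with respect to the $\nu$-completion of the Borel $\sigma$-field of $\{0,1\}^{\mathbb N\setminus\{i\}}$. Let the hat colours $\xi_1,\xi_2,\dots$ be i.i.d. with $\mathbb P(\xi_i=0)=\mathbb P(\xi_i=1)=\tfrac12$. Player $i$ guesses $X_i=f_i\big((\xi_j)_{j\ne i}\big)$; put $Z_i=1$ if $X_i=\xi_i$ and $Z_i=0$ otherwise, $\overline Z_k=\frac1k(Z_1+\dots+Z_k)$, and let $$L=\liminf_{k\to\infty}\overline Z_k,\qquad U=\limsup_{k\to\infty}\overline Z_k$$ be the lower and upper asymptotic densities of the set of players who guess correctly. For any $0\le \ell\le \tfrac12\le u\le 1$ there is a measurable strategy such that $L=\ell$ and $U=u$ almost surely. Moreover, for any Borel probability measure $\mu$ on $[0,\tfrac12]\times[\tfrac12,1]$ there is a measurable strategy such that $(L,U)$ has distribution $\mu$. -/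

import Mathlib

open MeasureTheory ProbabilityTheory Filter

noncomputable section

namespace HatGame

/-- The law of one fair coin flip on the two hat colours (`false` is black / 0, `true` is white / 1). -/
def fairCoin : Measure Bool := (PMF.uniformOfFintype Bool).toMeasure

instance : IsProbabilityMeasure fairCoin := by
  unfold fairCoin; infer_instance

/-- The coin-flipping measure on `{0,1}^ι`: the product of fair coins. -/
def coinMeasure (ι : Type*) : Measure (ι → Bool) := Measure.infinitePi fun _ : ι => fairCoin

/-- A strategy for countably many players. The players are indexed by `0, 1, 2, …`; the guess of
player `i` is a function of the hats of all the other players. -/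
def Strategy : Type := (i : ℕ) → ({j : ℕ // j ≠ i} → Bool) → Bool

namespace Strategy

/-- A strategy is measurable if each `f i` is measurable for the completion of the Borel
`σ`-algebra of `{0,1}^(ℕ ∖ {i})` under the coin-flipping measure. -/
def IsMeasurable (f : Strategy) : Prop :=
  ∀ i, NullMeasurable (f i) (coinMeasure {j : ℕ // j ≠ i})

/-- The guess of player `i` under the hat assignment `h`. -/
def guess (f : Strategy) (h : ℕ → Bool) (i : ℕ) : Bool := f i fun j => h j

/-- `Z_i`: the indicator that player `i` guesses correctly. -/
def correct (f : Strategy) (h : ℕ → Bool) (i : ℕ) : ℝ := if f.guess h i = h i then 1 else 0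

/-- The fraction of correct guesses among the first `k` players. -/
def fractionCorrect (f : Strategy) (h : ℕ → Bool) (k : ℕ) : ℝ :=
  (∑ i ∈ Finset.range k, f.correct h i) / k

/-- `L`: the lower asymptotic density of the set of players who guess correctly. -/
def lowerDensity (f : Strategy) (h : ℕ → Bool) : ℝ := liminf (f.fractionCorrect h) atTop

/-- `U`: the upper asymptotic density of the set of players who guess correctly. -/
def upperDensity (f : Strategy) (h : ℕ → Bool) : ℝ := limsup (f.fractionCorrect h) atTop

end Strategy

/-- The hat colours `ξ 0, ξ 1, …` are i.i.d. fair coin flips on the probability space `(Ω, P)`. -/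
structure IsFairHats {Ω : Type*} [MeasurableSpace Ω] (ξ : ℕ → Ω → Bool) (P : Measure Ω) :
    Prop where
  measurable : ∀ i, Measurable (ξ i)
  indep : iIndepFun ξ P
  law : ∀ i, P.map (ξ i) = fairCoin

end HatGame

end

namespace HatGame

/-! The players of a finite group can share one fair coin, the parity of their hats: whoever
supposes a value of the parity deduces a guess from the other hats of the group, and guesses
correctly exactly when the supposition is right. If a proportion `p` of a group supposes `true`,
then a proportion `p` or `1 - p` of it is correct, according to the parity. So the excess `W k` of
correct over wrong guesses moves with slope `±(2p - 1)` along the group.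

A block starting at `T` has a long neutral group (`p = 1/2`) followed by `K` groups of lengths `T,
2T, 4T, …`. These bet at the target density until the first loss and are neutral afterwards. As in
the doubling martingale, a first loss cancels all gains and leaves a net change of at most `T`,
negligible against `T (K + 1)`. If all `K` parities are `true`, the last groups dominate and `W k /
k` is close to `2p - 1` (`doubling_relative_bounds`). Even blocks aim at `u`, odd blocks at `l`; in
between, the relative excess stays between the two targets up to `O(1 / K)` (`excess_bounds`).

With `K` about `log₂ n` the error vanishes, while the winning probabilities `2 ^ (-K)` have infinite
sum. Parities of disjoint groups are independent, so by the second Borel–Cantelli lemma full wins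
recur in both kinds of block (`ae_frequently_win`).

For a random target, `(l, u)` is read off as a function of the first hats of all blocks. Those
players are neutral, so everyone who bets sees the target. The bounds hold pointwise, so the target
need not be independent of the parities. The deterministic statement is the case of a Dirac measure.
-/

instance (ι : Type*) : IsProbabilityMeasure (coinMeasure ι) := by
  unfold coinMeasure; infer_instance

theorem fairCoin_singleton (b : Bool) : fairCoin {b} = 2⁻¹ := by
  rw [fairCoin, PMF.toMeasure_apply_singleton _ _ (measurableSet_singleton b)]
  simp

theorem fairCoin_map_not : fairCoin.map Bool.not = fairCoin := by
  refine Measure.ext_of_singleton fun b => ?_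
  rw [Measure.map_apply (measurable_of_finite _) (measurableSet_singleton b)]
  have : Bool.not ⁻¹' {b} = {!b} := by ext c; cases b <;> cases c <;> simp
  rw [this, fairCoin_singleton, fairCoin_singleton]

/-- Change the hat of player `i`. -/
def flip (i : ℕ) (h : ℕ → Bool) : ℕ → Bool := fun j => if j = i then !(h j) else h j

theorem measurePreserving_flip (i : ℕ) :
    MeasurePreserving (flip i) (coinMeasure ℕ) (coinMeasure ℕ) := by
  have hm : ∀ j : ℕ, Measurable (fun b : Bool => if j = i then !b else b) :=
    fun j => measurable_of_finite _
  refine ⟨measurable_pi_lambda _ fun j => (hm j).comp (measurable_pi_apply j), ?_⟩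
  unfold coinMeasure
  refine (Measure.infinitePi_map_pi (fun _ : ℕ => fairCoin) hm).trans ?_
  congr 1
  ext1 j
  by_cases hj : j = i
  · simpa [hj] using fairCoin_map_not
  · simp [hj]

theorem coinMeasure_map_of_injective {g : ℕ → ℕ} (hg : Function.Injective g) :
    (coinMeasure ℕ).map (fun h n => h (g n)) = coinMeasure ℕ :=
  Measure.map_infinitePi_infinitePi_of_inj (P := fun _ : ℕ => fairCoin) hg

/-! ### Realising any law from coin flips, through the uniform distribution -/

/-- The number in `[0, 1]` with the given binary digits. -/
noncomputable def binary (h : ℕ → Bool) : ℝ :=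
  Real.ofDigits (fun n => if h n then (1 : Fin 2) else 0)

theorem measurable_binary : Measurable binary := by
  have : Continuous binary := Real.continuous_ofDigits.comp <|
    continuous_pi fun n => (continuous_of_discreteTopology
      (f := fun b : Bool => if b then (1 : Fin 2) else 0)).comp (continuous_apply n)
  exact this.measurable

theorem binary_mem_Icc (h : ℕ → Bool) : binary h ∈ Set.Icc (0 : ℝ) 1 :=
  ⟨Real.ofDigits_nonneg _, Real.ofDigits_le_one _⟩

theorem binary_eq (h : ℕ → Bool) :
    binary h = (if h 0 then 1 / 2 else 0) + binary (fun n => h (n + 1)) / 2 := by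
  unfold binary
  rw [Real.ofDigits_eq_sum_add_ofDigits _ 1]
  cases hh : h 0 <;> simp [Real.ofDigitsTerm, hh] <;> ring

/-- Averaging over the first digit splits off a factor; the remaining digits are again fair coins
and give the same variable, halved. -/
theorem charFun_binary (t : ℝ) :
    charFun ((coinMeasure ℕ).map binary) t =
      (1 + Complex.exp (t / 2 * Complex.I)) / 2 *
        charFun ((coinMeasure ℕ).map binary) (t / 2) := by
  have hint : ∀ (s : ℝ) (g : (ℕ → Bool) → ℝ), Measurable g →
      Integrable (fun h => Complex.exp (s * g h * Complex.I)) (coinMeasure ℕ) := by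
    intro s g hg
    refine Integrable.of_bound (C := 1) (by fun_prop) (ae_of_all _ fun h => ?_)
    rw [← Complex.ofReal_mul, Complex.norm_exp_ofReal_mul_I]
  have hI : ∀ s, charFun ((coinMeasure ℕ).map binary) s =
      ∫ h, Complex.exp (s * binary h * Complex.I) ∂(coinMeasure ℕ) := by
    intro s
    rw [charFun_apply_real, integral_map measurable_binary.aemeasurable (by fun_prop)]
  have hflip : ∫ h, Complex.exp (t * binary h * Complex.I) ∂(coinMeasure ℕ) =
      ∫ h, Complex.exp (t * binary (flip 0 h) * Complex.I) ∂(coinMeasure ℕ) := by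
    conv_lhs => rw [← (measurePreserving_flip 0).map_eq]
    rw [integral_map (measurePreserving_flip 0).measurable.aemeasurable]
    exact (Measurable.aestronglyMeasurable (by have := measurable_binary; fun_prop))
  have hshift : ∫ h, Complex.exp ((t / 2 : ℝ) * binary h * Complex.I) ∂(coinMeasure ℕ) =
      ∫ h, Complex.exp ((t / 2 : ℝ) * binary (fun n => h (n + 1)) * Complex.I)
        ∂(coinMeasure ℕ) := by
    conv_lhs => rw [← coinMeasure_map_of_injective (Nat.succ_injective)]
    rw [integral_map (Measurable.aemeasurable (by fun_prop))]
    exact (Measurable.aestronglyMeasurable (by have := measurable_binary; fun_prop))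
  have hsum : ∀ h, Complex.exp (t * binary h * Complex.I) +
      Complex.exp (t * binary (flip 0 h) * Complex.I) =
      (1 + Complex.exp (t / 2 * Complex.I)) *
        Complex.exp ((t / 2 : ℝ) * binary (fun n => h (n + 1)) * Complex.I) := by
    intro h
    have h1 := binary_eq h
    have h2 := binary_eq (flip 0 h)
    have h3 : (fun n => flip 0 h (n + 1)) = fun n => h (n + 1) := by
      funext n; simp [flip]
    rw [h3] at h2
    rw [h1, h2, add_mul, one_mul, ← Complex.exp_add]
    cases hh : h 0
    · simp only [flip, hh, if_true, Bool.not_false, Bool.false_eq_true, if_false]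
      push_cast
      congr 2 <;> ring
    · simp only [flip, hh, if_true, Bool.not_true, Bool.false_eq_true, if_false]
      push_cast
      rw [add_comm]
      congr 2 <;> ring
  rw [hI, hI, hshift, ← sub_eq_zero]
  have key : (∫ h, Complex.exp (t * binary h * Complex.I) ∂(coinMeasure ℕ)) +
      ∫ h, Complex.exp (t * binary h * Complex.I) ∂(coinMeasure ℕ) =
      (1 + Complex.exp (t / 2 * Complex.I)) *
      ∫ h, Complex.exp ((t / 2 : ℝ) * binary (fun n => h (n + 1)) * Complex.I)
        ∂(coinMeasure ℕ) := by
    -- Flipping hat `0` in only one of the two equal integrals makes the sum run over both values of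
    -- the first digit.
    conv_lhs => arg 2; rw [hflip]
    rw [← integral_add (hint _ _ measurable_binary)
      (hint _ (fun h => binary (flip 0 h))
        (measurable_binary.comp (measurePreserving_flip 0).measurable)),
      ← integral_const_mul]
    exact integral_congr_ae (ae_of_all _ hsum)
  linear_combination key / 2

/-- Self-similarity: the two halves of the interval are half-scale copies of the whole, the second
shifted by `1 / 2`. -/
theorem charFun_uniform (t : ℝ) :
    charFun ((volume : Measure ℝ).restrict (Set.Icc 0 1)) t =
      (1 + Complex.exp (t / 2 * Complex.I)) / 2 *
        charFun ((volume : Measure ℝ).restrict (Set.Icc 0 1)) (t / 2) := by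
  have hI : ∀ s : ℝ, charFun ((volume : Measure ℝ).restrict (Set.Icc 0 1)) s =
      ∫ x in (0 : ℝ)..1, Complex.exp (s * x * Complex.I) := by
    intro s
    rw [charFun_apply_real, intervalIntegral.integral_of_le zero_le_one,
      integral_Icc_eq_integral_Ioc]
  have hc : ∀ a b : ℝ, IntervalIntegrable
      (fun x : ℝ => Complex.exp (t * x * Complex.I)) volume a b :=
    fun a b => Continuous.intervalIntegrable (by fun_prop) _ _
  have h1 := intervalIntegral.integral_comp_div (a := 0) (b := 1)
    (fun x : ℝ => Complex.exp (t * x * Complex.I)) (c := 2) two_ne_zero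
  have h2 := intervalIntegral.integral_comp_div_add (a := 0) (b := 1)
    (fun x : ℝ => Complex.exp (t * x * Complex.I)) (c := 2) two_ne_zero (1 / 2)
  have h3 := intervalIntegral.integral_add_adjacent_intervals (hc 0 (1 / 2)) (hc (1 / 2) 1)
  have e1 : ∀ x : ℝ, Complex.exp (t * (x / 2 : ℝ) * Complex.I) =
      Complex.exp ((t / 2 : ℝ) * x * Complex.I) := by
    intro x; congr 1; push_cast; ring
  have e2 : ∀ x : ℝ, Complex.exp (t * (x / 2 + 1 / 2 : ℝ) * Complex.I) =
      Complex.exp (t / 2 * Complex.I) * Complex.exp ((t / 2 : ℝ) * x * Complex.I) := by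
    intro x; rw [← Complex.exp_add]; congr 1; push_cast; ring
  simp only [e1, e2, intervalIntegral.integral_const_mul] at h1 h2
  norm_num at h1 h2
  rw [hI, hI, ← h3]
  push_cast
  norm_num
  linear_combination -h1 / 2 - h2 / 2

theorem map_binary : (coinMeasure ℕ).map binary = (volume : Measure ℝ).restrict (Set.Icc 0 1) := by
  have : IsProbabilityMeasure ((coinMeasure ℕ).map binary) :=
    Measure.isProbabilityMeasure_map measurable_binary.aemeasurable
  have : IsProbabilityMeasure ((volume : Measure ℝ).restrict (Set.Icc 0 1)) := ⟨by simp⟩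
  apply Measure.ext_of_charFun
  ext t
  set φ := charFun ((coinMeasure ℕ).map binary)
  set ψ := charFun ((volume : Measure ℝ).restrict (Set.Icc 0 1))
  -- The common factor `(1 + exp (i s / 2)) / 2` has norm at most `1`, so the difference does not
  -- shrink when the argument is halved; but it is continuous and vanishes at `0`.
  have hle : ∀ n : ℕ, ‖φ t - ψ t‖ ≤ ‖φ (t * (1 / 2) ^ n) - ψ (t * (1 / 2) ^ n)‖ := by
    intro n
    induction n with
    | zero => simp
    | succ n ih =>
      refine ih.trans ?_
      set s := t * (1 / 2) ^ n with hs
      have e : t * (1 / 2) ^ (n + 1) = s / 2 := by rw [hs, pow_succ]; ring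
      rw [e]
      have h1 : φ s = _ := charFun_binary s
      have h2 : ψ s = _ := charFun_uniform s
      rw [h1, h2, ← mul_sub, norm_mul]
      refine mul_le_of_le_one_left (norm_nonneg _) ?_
      rw [norm_div, Complex.norm_ofNat, div_le_one (by norm_num)]
      refine (norm_add_le _ _).trans ?_
      have : (s : ℂ) / 2 * Complex.I = ((s / 2 : ℝ) : ℂ) * Complex.I := by push_cast; ring
      rw [this, Complex.norm_exp_ofReal_mul_I]
      norm_num
  have hlim : Tendsto (fun n : ℕ => t * (1 / 2 : ℝ) ^ n) atTop (nhds 0) := by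
    simpa using (tendsto_pow_atTop_nhds_zero_of_lt_one (by norm_num : (0 : ℝ) ≤ 1 / 2)
      (by norm_num)).const_mul t
  have hc : Tendsto (fun n : ℕ => ‖φ (t * (1 / 2) ^ n) - ψ (t * (1 / 2) ^ n)‖) atTop (nhds 0) := by
    have hφ : Continuous φ := by fun_prop
    have hψ : Continuous ψ := by fun_prop
    have := (((hφ.sub hψ).norm).tendsto 0).comp hlim
    simpa [φ, ψ, Function.comp_def] using this
  have := ge_of_tendsto' hc hle
  exact sub_eq_zero.1 (norm_le_zero_iff.1 this)

/-- Every Borel probability measure on a standard Borel space is an image of coin flips. -/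
theorem exists_measurable_map_coinMeasure {Y : Type*} [MeasurableSpace Y] [StandardBorelSpace Y]
    (μ : Measure Y) [IsProbabilityMeasure μ] :
    ∃ Φ : (ℕ → Bool) → Y, Measurable Φ ∧ (coinMeasure ℕ).map Φ = μ := by
  have := nonempty_of_isProbabilityMeasure μ
  obtain ⟨f, hf, hfμ⟩ := μ.exists_measurable_map_eq
  have hb : Measurable (fun h => (⟨binary h, binary_mem_Icc h⟩ : unitInterval)) :=
    measurable_binary.subtype_mk
  refine ⟨f ∘ fun h => ⟨binary h, binary_mem_Icc h⟩, hf.comp hb, ?_⟩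
  rw [← Measure.map_map hf hb, ← hfμ]
  congr 1
  have hE : MeasurableEmbedding ((↑) : unitInterval → ℝ) :=
    MeasurableEmbedding.subtype_coe measurableSet_Icc
  have : Measure.map (Subtype.val : unitInterval → ℝ)
      (Measure.map (fun h => (⟨binary h, binary_mem_Icc h⟩ : unitInterval)) (coinMeasure ℕ)) =
      Measure.map (Subtype.val : unitInterval → ℝ) volume := by
    rw [Measure.map_map hE.measurable hb, unitInterval.measurePreserving_coe.map_eq]
    exact map_binary
  rw [← hE.comap_map (Measure.map _ (coinMeasure ℕ)), this, hE.comap_map]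

/-! ### Group parities and their independence -/

instance : Std.Commutative Bool.xor := ⟨Bool.xor_comm⟩

instance : Std.Associative Bool.xor := ⟨Bool.xor_assoc⟩

/-- The parity of the number of white hats in `G`. -/
def parity (G : Finset ℕ) (h : ℕ → Bool) : Bool := G.fold Bool.xor false h

theorem parity_eq_xor_erase {G : Finset ℕ} {i : ℕ} (hi : i ∈ G) (h : ℕ → Bool) :
    parity G h = xor (h i) (parity (G.erase i) h) := by
  conv_lhs => rw [← Finset.insert_erase hi]
  exact Finset.fold_insert (Finset.notMem_erase i G)

theorem parity_congr {G : Finset ℕ} {h h' : ℕ → Bool} (H : ∀ i ∈ G, h i = h' i) :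
    parity G h = parity G h' :=
  Finset.fold_congr H

theorem measurable_parity (G : Finset ℕ) : Measurable (parity G) := by
  induction G using Finset.induction_on with
  | empty => exact measurable_const
  | insert a s ha ih =>
    have : parity (insert a s) = fun h => Function.uncurry Bool.xor (h a, parity s h) :=
      funext fun h => Finset.fold_insert ha
    rw [this]
    exact (measurable_of_finite (Function.uncurry Bool.xor)).comp
      ((measurable_pi_apply a).prodMk ih)

theorem parity_flip_of_notMem {G : Finset ℕ} {i : ℕ} (hi : i ∉ G) (h : ℕ → Bool) :
    parity G (flip i h) = parity G h :=
  parity_congr fun j hj => by simp [flip, show j ≠ i from fun e => hi (e ▸ hj)]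

theorem parity_flip_of_mem {G : Finset ℕ} {i : ℕ} (hi : i ∈ G) (h : ℕ → Bool) :
    parity G (flip i h) = !parity G h := by
  rw [parity_eq_xor_erase hi, parity_eq_xor_erase hi h,
    parity_flip_of_notMem (Finset.notMem_erase i G)]
  simp [flip]

theorem measurableSet_forall_parity {ι : Type*} (S : Finset ι) (G : ι → Finset ℕ) :
    MeasurableSet {h : ℕ → Bool | ∀ q ∈ S, parity (G q) h = true} := by
  have : {h : ℕ → Bool | ∀ q ∈ S, parity (G q) h = true} =
      ⋂ q ∈ S, parity (G q) ⁻¹' {true} := by ext; simp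
  rw [this]
  exact S.measurableSet_biInter fun q _ => measurable_parity _ (measurableSet_singleton _)

/-- The parities of disjoint nonempty groups are independent fair coins. -/
theorem coinMeasure_forall_parity {ι : Type*} [DecidableEq ι] (S : Finset ι) (G : ι → Finset ℕ)
    (hne : ∀ q ∈ S, (G q).Nonempty) (hd : (S : Set ι).PairwiseDisjoint G) :
    coinMeasure ℕ {h | ∀ q ∈ S, parity (G q) h = true} = 2⁻¹ ^ S.card := by
  induction S using Finset.induction_on with
  | empty => simp
  | insert q S hq ih =>
    have ih' := ih (fun r hr => hne r (Finset.mem_insert_of_mem hr))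
      (hd.subset (by simp))
    obtain ⟨i, hi⟩ := hne q (Finset.mem_insert_self _ _)
    have hiS : ∀ r ∈ S, i ∉ G r := fun r hr hir =>
      Finset.disjoint_left.1 (hd (by simp) (by simp [hr]) (ne_of_mem_of_not_mem hr hq).symm) hi hir
    set E : Set (ℕ → Bool) := {h | ∀ r ∈ S, parity (G r) h = true}
    have hE : MeasurableSet E := measurableSet_forall_parity S G
    set A : Set (ℕ → Bool) := parity (G q) ⁻¹' {true}
    have hA : MeasurableSet A := measurable_parity _ (measurableSet_singleton _)
    have hset : {h | ∀ r ∈ insert q S, parity (G r) h = true} = E ∩ A := by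
      ext h; simp [E, A, and_comm]
    -- Flipping one hat of the new group reverses its parity and no other, so `A` cuts `E` into two
    -- parts of equal measure.
    have hpre : flip i ⁻¹' (E ∩ A) = E \ A := by
      ext h
      simp only [E, A, Set.mem_preimage, Set.mem_inter_iff, Set.mem_ofPred_eq, Set.mem_sdiff,
        Set.mem_singleton_iff, parity_flip_of_mem hi]
      refine and_congr (forall₂_congr fun r hr => ?_) (by simp)
      rw [parity_flip_of_notMem (hiS r hr)]
    have heq : coinMeasure ℕ (E \ A) = coinMeasure ℕ (E ∩ A) := by
      rw [← hpre, (measurePreserving_flip i).measure_preimage (hE.inter hA).nullMeasurableSet]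
    have hadd := measure_inter_add_sdiff (μ := coinMeasure ℕ) E hA
    rw [heq, ih', ← two_mul] at hadd
    rw [hset, Finset.card_insert_of_notMem hq, pow_succ, ← hadd, mul_comm (2 : ENNReal), mul_assoc,
      ENNReal.mul_inv_cancel two_ne_zero ENNReal.ofNat_ne_top, mul_one]

/-- Second Borel–Cantelli lemma: an intersection of winning events is itself an event about disjoint
groups, so `coinMeasure_forall_parity` also gives the independence. -/
theorem ae_frequently_forall_parity (K : ℕ → ℕ) (G : ℕ → ℕ → Finset ℕ)
    (hne : ∀ n, ∀ j ∈ Finset.Icc 1 (K n), (G n j).Nonempty)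
    (hd : ∀ n n' j j', j ∈ Finset.Icc 1 (K n) → j' ∈ Finset.Icc 1 (K n') →
      (n, j) ≠ (n', j') → Disjoint (G n j) (G n' j'))
    (hK : ∑' n, (2⁻¹ : ENNReal) ^ K n = ⊤) :
    ∀ᵐ h ∂coinMeasure ℕ, ∃ᶠ n in atTop, ∀ j ∈ Finset.Icc 1 (K n), parity (G n j) h = true := by
  set A : ℕ → Set (ℕ → Bool) := fun n => {h | ∀ j ∈ Finset.Icc 1 (K n), parity (G n j) h = true}
  have hA : ∀ n, MeasurableSet (A n) := fun n => measurableSet_forall_parity _ _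
  have hP : ∀ n, coinMeasure ℕ (A n) = 2⁻¹ ^ K n := by
    intro n
    have := coinMeasure_forall_parity (Finset.Icc 1 (K n)) (G n) (hne n)
      (fun j hj j' hj' hjj => hd n n j j' hj hj' (by simpa using hjj))
    simpa [A] using this
  have hI : iIndepSet A (coinMeasure ℕ) := by
    rw [iIndepSet_iff_meas_biInter hA]
    intro S
    have hset : ⋂ n ∈ S, A n = {h | ∀ q ∈ S.sigma (fun n => Finset.Icc 1 (K n)),
        parity (G q.1 q.2) h = true} := by
      ext h
      simp only [A, Set.mem_iInter, Set.mem_ofPred_eq, Finset.mem_sigma]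
      exact ⟨fun H q hq => H q.1 hq.1 q.2 hq.2, fun H n hn j hj => H ⟨n, j⟩ ⟨hn, hj⟩⟩
    rw [hset, coinMeasure_forall_parity _ (fun q : (_ : ℕ) × ℕ => G q.1 q.2)]
    · simp [hP, Finset.card_sigma, Finset.prod_pow_eq_pow_sum]
    · intro q hq
      exact hne _ _ (Finset.mem_sigma.1 hq).2
    · rintro ⟨n, j⟩ hq ⟨n', j'⟩ hq' hqq
      refine hd n n' j j' (Finset.mem_sigma.1 hq).2 (Finset.mem_sigma.1 hq').2 ?_
      rintro e
      simp only [Prod.mk.injEq] at e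
      obtain ⟨rfl, rfl⟩ := e
      exact hqq rfl
  have h1 := measure_limsup_eq_one hA hI (by simpa [hP] using hK)
  have h2 : MeasurableSet (limsup A atTop) := MeasurableSet.measurableSet_limsup hA
  have h3 := (mem_ae_iff_prob_eq_one h2).2 h1
  filter_upwards [h3] with h hh
  exact mem_limsup_iff_frequently_mem.1 hh

/-! ### Deterministic analysis of one doubling block -/

/-- The doubling strategy: a sequence `W` is constant up to `2` on `[T, T(K+1)]`; on each interval
`[T(K+2^j), T(K+2^(j+1))]` it has slope `s j * a` as long as all earlier signs were `1`, and slope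
`0` afterwards. A first sign `-1` brings it down to `W T - a T`. -/
theorem doubling_bounds {W : ℕ → ℝ} {T K : ℕ} {a : ℝ} {s : ℕ → ℝ} (ha : 0 ≤ a)
    (hs : ∀ j, s j = 1 ∨ s j = -1)
    (h0 : |W (T * (K + 1)) - W T| ≤ 2)
    (hwin : ∀ j < K, (∀ i < j, s i = 1) → ∀ k, T * (K + 2 ^ j) ≤ k → k ≤ T * (K + 2 ^ (j + 1)) →
      |W k - W (T * (K + 2 ^ j)) - s j * a * (k - T * (K + 2 ^ j))| ≤ 2)
    (hlose : ∀ j < K, (¬ ∀ i < j, s i = 1) → ∀ k, T * (K + 2 ^ j) ≤ k →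
      k ≤ T * (K + 2 ^ (j + 1)) → |W k - W (T * (K + 2 ^ j))| ≤ 2)
    (J : ℕ) (hJ : J ≤ K) :
    ((∀ i < J, s i = 1) → |W (T * (K + 2 ^ J)) - W T - a * T * (2 ^ J - 1)| ≤ 2 * (J + 1)) ∧
    ((¬ ∀ i < J, s i = 1) → |W (T * (K + 2 ^ J)) - W T + a * T| ≤ 2 * (J + 1)) ∧
    (∀ k, T * (K + 1) ≤ k → k ≤ T * (K + 2 ^ J) →
      W T - a * T - 2 * (J + 1) ≤ W k ∧
      W k ≤ W T + a * (k - T * (K + 1)) + 2 * (J + 1)) := by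
  have haT : 0 ≤ a * T := mul_nonneg ha (Nat.cast_nonneg _)
  induction J with
  | zero =>
    refine ⟨fun _ => by simpa using h0, fun h => absurd (fun i hi => absurd hi (by simp)) h, ?_⟩
    intro k hk1 hk2
    rw [pow_zero] at hk2
    obtain rfl := le_antisymm hk2 hk1
    rw [abs_le] at h0
    push_cast
    constructor <;> nlinarith
  | succ J ih =>
    obtain ⟨ihw, ihl, ihb⟩ := ih (by omega)
    have hJK : J < K := by omega
    have hx : T * (K + 2 ^ J) ≤ T * (K + 2 ^ (J + 1)) := by
      gcongr <;> omega
    have hy : ((T * (K + 2 ^ (J + 1)) : ℕ) : ℝ) - T * (K + 2 ^ J) = T * 2 ^ J := by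
      push_cast; ring
    have hsucc : (∀ i < J + 1, s i = 1) ↔ (∀ i < J, s i = 1) ∧ s J = 1 :=
      ⟨fun H => ⟨fun i hi => H i (by omega), H J (by omega)⟩, fun H i hi => by
        rcases Nat.lt_succ_iff_lt_or_eq.1 hi with h | rfl
        exacts [H.1 i h, H.2]⟩
    by_cases hw : ∀ i < J, s i = 1
    · have A := ihw hw
      have B := hwin J hJK hw
      have C := B _ hx le_rfl
      rw [hy] at C
      rw [abs_le] at A
      refine ⟨fun H => ?_, fun H => ?_, ?_⟩
      · rw [(hsucc.1 H).2] at C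
        rw [abs_le] at C ⊢
        push_cast
        have e : a * T * ((2 : ℝ) ^ (J + 1) - 1) = a * T * (2 ^ J - 1) + 1 * a * (T * 2 ^ J) := by
          ring
        rw [e]
        constructor <;> linarith
      -- First loss: the gain `a T (2 ^ J - 1)` so far minus the loss `a T 2 ^ J` leaves `-a T`.
      · have hsJ : s J = -1 := (hs J).resolve_left fun h => H (hsucc.2 ⟨hw, h⟩)
        rw [hsJ] at C
        rw [abs_le] at C ⊢
        push_cast
        constructor <;> nlinarith
      · intro k hk1 hk2
        rcases le_total k (T * (K + 2 ^ J)) with hk | hk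
        · obtain ⟨h1, h2⟩ := ihb k hk1 hk
          push_cast
          constructor <;> linarith
        · have D := B k hk hk2
          rw [abs_le] at D
          have hk' : ((T * (K + 2 ^ J) : ℕ) : ℝ) ≤ k := by exact_mod_cast hk
          have hk2' : (k : ℝ) ≤ ((T * (K + 2 ^ (J + 1)) : ℕ) : ℝ) := by exact_mod_cast hk2
          push_cast at hk' hk2' ⊢
          rw [pow_succ] at hk2'
          have p1 : 0 ≤ a * (k - T * (K + 2 ^ J)) := mul_nonneg ha (by linarith)
          have p2 : a * (k - T * (K + 2 ^ J)) ≤ a * (T * 2 ^ J) :=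
            mul_le_mul_of_nonneg_left (by linarith) ha
          have p3 : (1 : ℝ) ≤ 2 ^ J := one_le_pow₀ (by norm_num)
          have p4 : 0 ≤ a * T * (2 ^ J - 1) := mul_nonneg haT (by linarith)
          rcases hs J with h | h <;> rw [h] at D <;> constructor <;> nlinarith
    · have A := ihl hw
      have B := hlose J hJK hw
      have C := B _ hx le_rfl
      rw [abs_le] at A C
      refine ⟨fun H => absurd (hsucc.1 H).1 hw, fun H => ?_, ?_⟩
      · rw [abs_le]
        push_cast
        constructor <;> linarith
      · intro k hk1 hk2
        rcases le_total k (T * (K + 2 ^ J)) with hk | hk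
        · obtain ⟨h1, h2⟩ := ihb k hk1 hk
          push_cast
          constructor <;> linarith
        · have D := B k hk hk2
          rw [abs_le] at D
          have hk1' : ((T * (K + 1) : ℕ) : ℝ) ≤ k := by exact_mod_cast hk1
          push_cast at hk1' ⊢
          have p1 : 0 ≤ a * (k - T * (K + 1)) := mul_nonneg ha (by linarith)
          constructor <;> linarith

theorem add_one_sq_le_four_mul_two_pow (K : ℕ) : (K + 1) ^ 2 ≤ 4 * 2 ^ K := by
  induction K with
  | zero => norm_num
  | succ n ih =>
    rcases Nat.lt_or_ge n 2 with h | h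
    · interval_cases n <;> norm_num
    · rw [pow_succ 2 n]; nlinarith

/-- Relative form of `doubling_bounds`, when `W` is at most `T` in absolute value at the start. -/
theorem doubling_relative_bounds {W : ℕ → ℝ} {T K : ℕ} {a : ℝ} {s : ℕ → ℝ} (ha : 0 ≤ a)
    (ha1 : a ≤ 1) (hWT : |W T| ≤ T) (hK : (K + 1) ^ 2 ≤ 4 * T)
    (hs : ∀ j, s j = 1 ∨ s j = -1)
    (h0 : |W (T * (K + 1)) - W T| ≤ 2)
    (hwin : ∀ j < K, (∀ i < j, s i = 1) → ∀ k, T * (K + 2 ^ j) ≤ k → k ≤ T * (K + 2 ^ (j + 1)) →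
      |W k - W (T * (K + 2 ^ j)) - s j * a * (k - T * (K + 2 ^ j))| ≤ 2)
    (hlose : ∀ j < K, (¬ ∀ i < j, s i = 1) → ∀ k, T * (K + 2 ^ j) ≤ k →
      k ≤ T * (K + 2 ^ (j + 1)) → |W k - W (T * (K + 2 ^ j))| ≤ 2) :
    (∀ k, T * (K + 1) ≤ k → k ≤ T * (K + 2 ^ K) →
      -(21 / (K + 1 : ℝ) * k) ≤ W k ∧ W k ≤ (a + 21 / (K + 1 : ℝ)) * k) ∧
    ((∀ i < K, s i = 1) →
      (a - 21 / (K + 1 : ℝ)) * (T * (K + 2 ^ K) : ℕ) ≤ W (T * (K + 2 ^ K))) := by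
  obtain ⟨hw, -, hb⟩ := doubling_bounds ha hs h0 hwin hlose K le_rfl
  have hKp : (0 : ℝ) < K + 1 := by positivity
  have hT0 : (0 : ℝ) ≤ T := Nat.cast_nonneg _
  have hK' : ((K : ℝ) + 1) ^ 2 ≤ 4 * T := by exact_mod_cast hK
  have hK2 : ((K : ℝ) + 1) ^ 2 ≤ 4 * 2 ^ K := by exact_mod_cast add_one_sq_le_four_mul_two_pow K
  have hpow : 1 ≤ 2 ^ K := Nat.one_le_two_pow
  have haT : a * T ≤ T := mul_le_of_le_one_left hT0 ha1
  rw [abs_le] at hWT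
  -- Every error term is a multiple of `k / (K + 1)`: `T` and `a T` count once, `2 (K + 1)` counts 8
  -- times, and `a T (K + 1)` at the end of the block 4 times. The constant `21` leaves room.
  have small : ∀ k : ℕ, T * (K + 1) ≤ k →
      (T : ℝ) ≤ 1 / (K + 1 : ℝ) * k ∧ (K + 1 : ℝ) ≤ 4 * (1 / (K + 1 : ℝ) * k) := by
    intro k hk
    have hk' : (T : ℝ) * (K + 1) ≤ k := by exact_mod_cast hk
    have h1 : (T : ℝ) ≤ 1 / (K + 1 : ℝ) * k := by
      rw [one_div_mul_eq_div, le_div_iff₀ hKp]; exact hk'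
    refine ⟨h1, ?_⟩
    have h2 : (K + 1 : ℝ) ≤ 4 * T := by nlinarith
    linarith
  constructor
  · intro k hk1 hk2
    obtain ⟨h1, h2⟩ := hb k hk1 hk2
    obtain ⟨h3, h4⟩ := small k hk1
    have e : 21 / (K + 1 : ℝ) * k = 21 * (1 / (K + 1 : ℝ) * k) := by ring
    have p : 0 ≤ a * (T * (K + 1)) := by positivity
    rw [add_mul, e]
    constructor <;> nlinarith
  · intro H
    have h1 := hw H
    rw [abs_le] at h1
    set k := T * (K + 2 ^ K) with hk
    obtain ⟨h3, h4⟩ := small k (hk ▸ Nat.mul_le_mul_left _ (by omega))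
    have e : 21 / (K + 1 : ℝ) * k = 21 * (1 / (K + 1 : ℝ) * k) := by ring
    have h5 : (T : ℝ) * (K + 1) ≤ 4 * (1 / (K + 1 : ℝ) * k) := by
      have : (T : ℝ) * (K + 1) ≤ 4 * k / (K + 1) := by
        rw [le_div_iff₀ hKp, hk]
        push_cast
        nlinarith
      calc _ ≤ _ := this
        _ = _ := by ring
    have h6 : a * (T * (K + 1)) ≤ T * (K + 1) := mul_le_of_le_one_left (by positivity) ha1
    have hkr : (k : ℝ) = T * (K + 2 ^ K) := by rw [hk]; push_cast; ring
    have h7 : a * T * (2 ^ K - 1) = a * k - a * (T * (K + 1)) := by rw [hkr]; ring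
    rw [sub_mul, e]
    linarith

/-! ### Upper and lower limits from approximate bounds -/

theorem limsup_eq_of_eventually_of_frequently {x : ℕ → ℝ} {u : ℝ}
    (hb : ∀ k, 0 ≤ x k) (hb' : ∀ k, x k ≤ 1)
    (h1 : ∀ ε > 0, ∀ᶠ k in atTop, x k ≤ u + ε) (h2 : ∀ ε > 0, ∃ᶠ k in atTop, u - ε ≤ x k) :
    limsup x atTop = u := by
  have c1 : IsBoundedUnder (· ≤ ·) atTop x := isBoundedUnder_of ⟨1, hb'⟩
  have c2 : IsBoundedUnder (· ≥ ·) atTop x := isBoundedUnder_of ⟨0, hb⟩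
  apply le_antisymm
  · exact le_of_forall_pos_le_add fun ε hε => limsup_le_of_le c2.isCoboundedUnder_le (h1 ε hε)
  · refine le_of_forall_pos_le_add fun ε hε => ?_
    have := le_limsup_of_frequently_le (h2 ε hε) c1
    linarith

theorem liminf_eq_of_eventually_of_frequently {x : ℕ → ℝ} {l : ℝ}
    (hb : ∀ k, 0 ≤ x k) (hb' : ∀ k, x k ≤ 1)
    (h1 : ∀ ε > 0, ∀ᶠ k in atTop, l - ε ≤ x k) (h2 : ∀ ε > 0, ∃ᶠ k in atTop, x k ≤ l + ε) :
    liminf x atTop = l := by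
  have c1 : IsBoundedUnder (· ≤ ·) atTop x := isBoundedUnder_of ⟨1, hb'⟩
  have c2 : IsBoundedUnder (· ≥ ·) atTop x := isBoundedUnder_of ⟨0, hb⟩
  apply le_antisymm
  · exact le_of_forall_pos_le_add fun ε hε => liminf_le_of_frequently_le (h2 ε hε) c2
  · refine le_of_forall_pos_le_add fun ε hε => ?_
    have := le_liminf_of_le c1.isCoboundedUnder_ge (h1 ε hε)
    linarith

/-! ### Blocks and groups of players -/

/-- The number of betting rounds in block `n`. -/
def rounds (n : ℕ) : ℕ := Nat.log 2 (n + 2)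

/-- The first player of block `n`. -/
def blockStart : ℕ → ℕ
  | 0 => 1
  | n + 1 => blockStart n * (rounds n + 2 ^ rounds n)

/-- The first player of group `j` of block `n`. Group `0` is the neutral group. -/
def groupStart (n : ℕ) : ℕ → ℕ
  | 0 => blockStart n
  | j + 1 => blockStart n * (rounds n + 2 ^ j)

/-- Group `j` of block `n`. -/
def group (n j : ℕ) : Finset ℕ := Finset.Ico (groupStart n j) (groupStart n (j + 1))

theorem one_le_rounds (n : ℕ) : 1 ≤ rounds n := Nat.log_pos one_lt_two (by omega)

theorem rounds_mono : Monotone rounds := fun _ _ h => Nat.log_mono_right (by omega)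

theorem rounds_le (n : ℕ) : rounds n ≤ n + 1 := by
  have : Nat.log 2 (n + 2) < n + 2 := Nat.log_lt_self 2 (by omega)
  unfold rounds; omega

theorem tendsto_rounds : Tendsto rounds atTop atTop := by
  refine tendsto_atTop_atTop_of_monotone rounds_mono fun b => ⟨2 ^ b, ?_⟩
  exact (Nat.le_log_of_pow_le one_lt_two (by omega))

/-- Keeps the probability of a full win at least `1 / (n + 2)`, hence not summable. -/
theorem two_pow_rounds_le (n : ℕ) : 2 ^ rounds n ≤ n + 2 := Nat.pow_log_le_self 2 (by omega)

theorem groupStart_end (n : ℕ) : groupStart n (rounds n + 1) = blockStart (n + 1) := rfl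

theorem three_pow_le_blockStart (n : ℕ) : 3 ^ n ≤ blockStart n := by
  induction n with
  | zero => simp [blockStart]
  | succ n ih =>
    rw [pow_succ, blockStart]
    have h1 := one_le_rounds n
    have h2 : 2 ^ 1 ≤ 2 ^ rounds n := Nat.pow_le_pow_right (by norm_num) h1
    exact Nat.mul_le_mul ih (by omega)

theorem blockStart_pos (n : ℕ) : 0 < blockStart n :=
  (Nat.pow_pos (by norm_num)).trans_le (three_pow_le_blockStart n)

/-- Blocks grow exponentially, so the rounding errors, bounded per group, are negligible against the
block start. -/
theorem rounds_add_one_sq_le (n : ℕ) : (rounds n + 1) ^ 2 ≤ 4 * blockStart n := by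
  have h1 : (rounds n + 1) ^ 2 ≤ (n + 2) ^ 2 := Nat.pow_le_pow_left (by have := rounds_le n; omega) 2
  have h2 : ∀ n : ℕ, (n + 2) ^ 2 ≤ 4 * 3 ^ n := by
    intro n
    induction n with
    | zero => norm_num
    | succ n ih =>
      rw [pow_succ 3 n]
      have : (n + 1 + 2) ^ 2 + (2 * n ^ 2 + 6 * n + 3) = 3 * (n + 2) ^ 2 := by ring
      omega
  have := three_pow_le_blockStart n
  have := h2 n
  omega

theorem groupStart_strictMono (n : ℕ) : StrictMono (groupStart n) := by
  refine strictMono_nat_of_lt_succ fun j => ?_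
  have hT := blockStart_pos n
  have h1 := one_le_rounds n
  cases j with
  | zero =>
    change blockStart n < blockStart n * (rounds n + 2 ^ 0)
    nlinarith
  | succ j =>
    change blockStart n * (rounds n + 2 ^ j) < blockStart n * (rounds n + 2 ^ (j + 1))
    have : 2 ^ j < 2 ^ (j + 1) := Nat.pow_lt_pow_right (by norm_num) (by omega)
    exact Nat.mul_lt_mul_of_pos_left (by omega) hT

theorem blockStart_strictMono : StrictMono blockStart :=
  strictMono_nat_of_lt_succ fun n => by
    rw [← groupStart_end]
    exact groupStart_strictMono n (Nat.succ_pos _)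

theorem groupStart_le_blockStart {n j : ℕ} (hj : j ≤ rounds n + 1) :
    groupStart n j ≤ blockStart (n + 1) := by
  rw [← groupStart_end]
  exact (groupStart_strictMono n).monotone hj

theorem blockStart_le_groupStart (n j : ℕ) : blockStart n ≤ groupStart n j :=
  (groupStart_strictMono n).monotone (Nat.zero_le j)

/-- The block of player `i`. -/
def blockOf (i : ℕ) : ℕ := Nat.findGreatest (fun n => blockStart n ≤ i) i

/-- The group of player `i` in its block. -/
def groupOf (i : ℕ) : ℕ :=
  Nat.findGreatest (fun j => groupStart (blockOf i) j ≤ i) (rounds (blockOf i))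

theorem blockOf_eq {n i : ℕ} (h1 : blockStart n ≤ i) (h2 : i < blockStart (n + 1)) :
    blockOf i = n := by
  refine Nat.findGreatest_eq_iff.2 ⟨(blockStart_strictMono.le_apply).trans h1, fun _ => h1, ?_⟩
  intro m hm _ hmi
  exact absurd (h2.trans_le (blockStart_strictMono.monotone hm)) (by omega)

theorem blockOf_eq_of_mem_group {n j i : ℕ} (hj : j ≤ rounds n) (hi : i ∈ group n j) :
    blockOf i = n := by
  have hi := Finset.mem_Ico.1 hi
  exact blockOf_eq ((blockStart_le_groupStart n j).trans hi.1)
    (hi.2.trans_le (groupStart_le_blockStart (by omega)))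

theorem groupOf_eq_of_mem_group {n j i : ℕ} (hj : j ≤ rounds n) (hi : i ∈ group n j) :
    groupOf i = j := by
  have hb := blockOf_eq_of_mem_group hj hi
  have hi := Finset.mem_Ico.1 hi
  unfold groupOf
  rw [hb]
  refine Nat.findGreatest_eq_iff.2 ⟨hj, fun _ => hi.1, ?_⟩
  intro m hm _ hmi
  exact absurd (hi.2.trans_le ((groupStart_strictMono n).monotone hm)) (by omega)

theorem disjoint_group {n n' j j' : ℕ} (hj : j ≤ rounds n) (hj' : j' ≤ rounds n')
    (hne : (n, j) ≠ (n', j')) : Disjoint (group n j) (group n' j') := by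
  rw [Finset.disjoint_left]
  intro i hi hi'
  exact hne (Prod.ext ((blockOf_eq_of_mem_group hj hi).symm.trans (blockOf_eq_of_mem_group hj' hi'))
    ((groupOf_eq_of_mem_group hj hi).symm.trans (groupOf_eq_of_mem_group hj' hi')))

theorem blockStart_mem_group (n : ℕ) : blockStart n ∈ group n 0 :=
  Finset.mem_Ico.2 ⟨le_rfl, groupStart_strictMono n (Nat.succ_pos _)⟩

theorem exists_blockStart_le {N k : ℕ} (hk : blockStart N ≤ k) :
    ∃ n ≥ N, blockStart n ≤ k ∧ k < blockStart (n + 1) := by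
  -- Since `n ≤ blockStart n`, the search bound in `blockOf` excludes no candidate.
  have hN : N ≤ k := blockStart_strictMono.le_apply.trans hk
  refine ⟨blockOf k, Nat.le_findGreatest hN hk, ?_, ?_⟩
  · exact Nat.findGreatest_spec (P := fun n => blockStart n ≤ k) hN hk
  · by_contra h
    push Not at h
    have h1 : blockOf k + 1 ≤ k := blockStart_strictMono.le_apply.trans h
    have : blockOf k + 1 ≤ blockOf k :=
      Nat.le_findGreatest (P := fun n => blockStart n ≤ k) h1 h
    omega

theorem tsum_two_inv_pow_eq_top {K : ℕ → ℕ} (hK : ∀ n, 2 ^ K n ≤ 2 * n + 3) :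
    ∑' n, (2⁻¹ : ENNReal) ^ K n = ⊤ := by
  by_contra h
  have hs := ENNReal.summable_toReal h
  have hle : ∀ n : ℕ, (1 / 3 : ℝ) * (1 / ((n + 1 : ℕ) : ℝ)) ≤ ((2⁻¹ : ENNReal) ^ K n).toReal := by
    intro n
    have h1 : (2 : ℝ) ^ K n ≤ 2 * n + 3 := by exact_mod_cast hK n
    rw [ENNReal.toReal_pow, ENNReal.toReal_inv, ENNReal.toReal_ofNat, inv_pow, ← one_div,
      one_div_mul_one_div]
    refine one_div_le_one_div_of_le (by positivity) (h1.trans ?_)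
    push_cast
    linarith [(Nat.cast_nonneg n : (0 : ℝ) ≤ n)]
  have h2 : Summable fun n : ℕ => (1 / 3 : ℝ) * (1 / ((n + 1 : ℕ) : ℝ)) :=
    Summable.of_nonneg_of_le (fun n => by positivity) hle hs
  rw [summable_mul_left_iff (by norm_num)] at h2
  exact Real.not_summable_one_div_natCast ((summable_nat_add_iff 1).1 h2)

/-! ### The parity strategy -/

/-- The bet of player `i` at density `p`: among the players `x, …, y - 1` the number of bets on
`true` is `⌊y p⌋ - ⌊x p⌋`. -/
noncomputable def bet (i : ℕ) (p : ℝ) : Bool := decide (⌊((i + 1 : ℕ) : ℝ) * p⌋ - ⌊(i : ℝ) * p⌋ = 1)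

theorem bet_eq {p : ℝ} (h0 : 0 ≤ p) (h1 : p ≤ 1) (i : ℕ) :
    (if bet i p = true then (1 : ℝ) else 0) = ⌊((i + 1 : ℕ) : ℝ) * p⌋ - ⌊(i : ℝ) * p⌋ := by
  have a1 : ⌊(i : ℝ) * p⌋ ≤ ⌊((i + 1 : ℕ) : ℝ) * p⌋ := Int.floor_mono (by push_cast; nlinarith)
  have a2 : ⌊((i + 1 : ℕ) : ℝ) * p⌋ ≤ ⌊(i : ℝ) * p⌋ + 1 := by
    rw [← Int.floor_add_one]
    exact Int.floor_mono (by push_cast; nlinarith)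
  by_cases h : ⌊((i + 1 : ℕ) : ℝ) * p⌋ - ⌊(i : ℝ) * p⌋ = 1
  · simp only [bet, h, decide_true, if_true]
    exact_mod_cast h.symm
  · simp only [bet, h, decide_false, Bool.false_eq_true, if_false]
    have : ⌊((i + 1 : ℕ) : ℝ) * p⌋ - ⌊(i : ℝ) * p⌋ = 0 := by omega
    exact_mod_cast this.symm

theorem measurable_bet (i : ℕ) : Measurable (bet i) := by
  have : Measurable fun p : ℝ => ⌊((i + 1 : ℕ) : ℝ) * p⌋ - ⌊(i : ℝ) * p⌋ := by fun_prop
  exact (Measurable.of_discrete (f := fun z : ℤ => decide (z = 1))).comp this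

/-- The density at which group `j` of block `n` bets: neutral in group `0` and after a lost group
of the block, and the target density otherwise. -/
noncomputable def stake (Φ : (ℕ → Bool) → ℝ × ℝ) (n j : ℕ) (h : ℕ → Bool) : ℝ :=
  if j ≠ 0 ∧ ∀ j' ∈ Finset.Ico 1 j, parity (group n j') h = true then
    if Even n then (Φ fun m => h (blockStart m)).2 else (Φ fun m => h (blockStart m)).1
  else 1 / 2

theorem measurable_stake {Φ : (ℕ → Bool) → ℝ × ℝ} (hΦ : Measurable Φ) (n j : ℕ) :
    Measurable (stake Φ n j) := by
  have hr : Measurable fun (h : ℕ → Bool) (m : ℕ) => h (blockStart m) := by fun_prop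
  refine Measurable.ite ?_ ?_ measurable_const
  · by_cases hj : j = 0
    · simp [hj]
    · simpa [hj] using measurableSet_forall_parity (Finset.Ico 1 j) (group n)
  · by_cases hn : Even n
    · simp only [hn, if_true]; exact (hΦ.comp hr).snd
    · simp only [hn, if_false]; exact (hΦ.comp hr).fst

/-- Each player can compute the stake without its own hat: the target uses only hats of players in
groups `0`, which ignore it, and the win record uses only earlier groups. -/
theorem stake_congr (Φ : (ℕ → Bool) → ℝ × ℝ) {n j i : ℕ} (hj : j ≤ rounds n) (hi : i ∈ group n j)
    {h h' : ℕ → Bool} (H : ∀ k ≠ i, h k = h' k) : stake Φ n j h = stake Φ n j h' := by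
  unfold stake
  by_cases hj0 : j = 0
  · simp [hj0]
  have h1 : (fun m => h (blockStart m)) = fun m => h' (blockStart m) := by
    funext m
    refine H _ ?_
    rintro rfl
    exact hj0 ((groupOf_eq_of_mem_group hj hi).symm.trans
      (groupOf_eq_of_mem_group (Nat.zero_le _) (blockStart_mem_group m)))
  have h2 : ∀ j' ∈ Finset.Ico 1 j, parity (group n j') h = parity (group n j') h' := by
    intro j' hj'
    have hj' := Finset.mem_Ico.1 hj'
    refine parity_congr fun k hk => H k ?_
    rintro rfl
    have e1 := groupOf_eq_of_mem_group hj hi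
    have e2 := groupOf_eq_of_mem_group (by omega) hk
    omega
  rw [h1]
  congr 1
  simp only [hj0, ne_eq, not_false_eq_true, true_and, eq_iff_iff]
  exact forall₂_congr fun j' hj' => by rw [h2 j' hj']

/-- Complete the view of player `i` to a hat assignment. -/
def complete (i : ℕ) (x : {j : ℕ // j ≠ i} → Bool) : ℕ → Bool :=
  -- The default `false` has no effect for a player in its group: the parity omits `i`, and
  -- `stake_congr` covers the stake.
  fun k => if hk : k ≠ i then x ⟨k, hk⟩ else false

/-- Every player bets on the parity of its group. -/
noncomputable def parityStrategy (Φ : (ℕ → Bool) → ℝ × ℝ) : Strategy := fun i x =>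
  xor (parity ((group (blockOf i) (groupOf i)).erase i) (complete i x))
    (bet i (stake Φ (blockOf i) (groupOf i) (complete i x)))

theorem isMeasurable_parityStrategy {Φ : (ℕ → Bool) → ℝ × ℝ} (hΦ : Measurable Φ) :
    (parityStrategy Φ).IsMeasurable := by
  intro i
  have hc : Measurable (complete i) := by
    refine measurable_pi_lambda _ fun k => ?_
    by_cases hk : k ≠ i
    · simpa [complete, hk] using measurable_pi_apply _
    · simp [complete, hk]
  have h1 : Measurable fun x => parity ((group (blockOf i) (groupOf i)).erase i) (complete i x) :=
    (measurable_parity _).comp hc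
  have h2 : Measurable fun x => bet i (stake Φ (blockOf i) (groupOf i) (complete i x)) :=
    (measurable_bet i).comp ((measurable_stake hΦ _ _).comp hc)
  have h3 := (measurable_of_finite (Function.uncurry Bool.xor)).comp (h1.prodMk h2)
  exact h3.nullMeasurable

theorem correct_parityStrategy (Φ : (ℕ → Bool) → ℝ × ℝ) {n j i : ℕ} (hj : j ≤ rounds n)
    (hi : i ∈ group n j) (h : ℕ → Bool) :
    (parityStrategy Φ).correct h i =
      if parity (group n j) h = bet i (stake Φ n j h) then 1 else 0 := by
  have hcomp : ∀ k ≠ i, complete i (fun j => h j) k = h k := by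
    intro k hk; simp [complete, hk]
  have hg : (parityStrategy Φ).guess h i =
      xor (parity ((group n j).erase i) h) (bet i (stake Φ n j h)) := by
    unfold Strategy.guess parityStrategy
    rw [blockOf_eq_of_mem_group hj hi, groupOf_eq_of_mem_group hj hi, stake_congr Φ hj hi hcomp,
      parity_congr (h' := h) fun k hk => hcomp k (Finset.ne_of_mem_erase hk)]
  unfold Strategy.correct
  rw [hg, parity_eq_xor_erase hi]
  congr 1
  cases parity ((group n j).erase i) h <;> cases bet i (stake Φ n j h) <;> cases h i <;> simp

/-! ### From excess to densities -/

namespace Strategy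

/-- The number of correct minus the number of wrong guesses among the first `k` players. -/
noncomputable def excess (f : Strategy) (h : ℕ → Bool) (k : ℕ) : ℝ :=
  2 * ∑ i ∈ Finset.range k, f.correct h i - k

theorem correct_nonneg (f : Strategy) (h : ℕ → Bool) (i : ℕ) : 0 ≤ f.correct h i := by
  unfold correct; split_ifs <;> norm_num

theorem correct_le_one (f : Strategy) (h : ℕ → Bool) (i : ℕ) : f.correct h i ≤ 1 := by
  unfold correct; split_ifs <;> norm_num

theorem sum_correct_nonneg (f : Strategy) (h : ℕ → Bool) (k : ℕ) :
    0 ≤ ∑ i ∈ Finset.range k, f.correct h i :=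
  Finset.sum_nonneg fun i _ => f.correct_nonneg h i

theorem sum_correct_le (f : Strategy) (h : ℕ → Bool) (k : ℕ) :
    ∑ i ∈ Finset.range k, f.correct h i ≤ k :=
  (Finset.sum_le_card_nsmul _ _ 1 fun i _ => f.correct_le_one h i).trans (by simp)

theorem abs_excess_le (f : Strategy) (h : ℕ → Bool) (k : ℕ) : |f.excess h k| ≤ k := by
  have h1 := f.sum_correct_nonneg h k
  have h2 := f.sum_correct_le h k
  rw [abs_le]
  unfold excess
  constructor <;> linarith

theorem fractionCorrect_nonneg (f : Strategy) (h : ℕ → Bool) (k : ℕ) :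
    0 ≤ f.fractionCorrect h k :=
  div_nonneg (f.sum_correct_nonneg h k) (Nat.cast_nonneg k)

theorem fractionCorrect_le_one (f : Strategy) (h : ℕ → Bool) (k : ℕ) :
    f.fractionCorrect h k ≤ 1 :=
  div_le_one_of_le₀ (f.sum_correct_le h k) (Nat.cast_nonneg k)

theorem fractionCorrect_eq (f : Strategy) (h : ℕ → Bool) {k : ℕ} (hk : 0 < k) :
    f.fractionCorrect h k = (1 + f.excess h k / k) / 2 := by
  have : (k : ℝ) ≠ 0 := by positivity
  unfold fractionCorrect excess
  field_simp
  ring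

/-- The densities are determined by the asymptotic bounds of the relative excess. -/
theorem densities_eq (f : Strategy) (h : ℕ → Bool) {l u : ℝ}
    (h1 : ∀ ε > 0, ∀ᶠ k : ℕ in atTop, (2 * l - 1 - ε) * k ≤ f.excess h k ∧
      f.excess h k ≤ (2 * u - 1 + ε) * k)
    (h2 : ∀ ε > 0, ∃ᶠ k : ℕ in atTop, (2 * u - 1 - ε) * k ≤ f.excess h k)
    (h3 : ∀ ε > 0, ∃ᶠ k : ℕ in atTop, f.excess h k ≤ (2 * l - 1 + ε) * k) :
    f.lowerDensity h = l ∧ f.upperDensity h = u := by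
  have hpos : ∀ᶠ k : ℕ in atTop, 0 < k := eventually_gt_atTop 0
  have hle : ∀ {k : ℕ} {c : ℝ}, 0 < k → f.excess h k ≤ (2 * c - 1) * k →
      f.fractionCorrect h k ≤ c := by
    intro k c hk H
    have hk' : (0 : ℝ) < k := by exact_mod_cast hk
    rw [f.fractionCorrect_eq h hk]
    have := (div_le_iff₀ hk').2 H
    linarith
  have hge : ∀ {k : ℕ} {c : ℝ}, 0 < k → (2 * c - 1) * k ≤ f.excess h k →
      c ≤ f.fractionCorrect h k := by
    intro k c hk H
    have hk' : (0 : ℝ) < k := by exact_mod_cast hk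
    rw [f.fractionCorrect_eq h hk]
    have := (le_div_iff₀ hk').2 H
    linarith
  constructor
  · refine liminf_eq_of_eventually_of_frequently (f.fractionCorrect_nonneg h)
      (f.fractionCorrect_le_one h) (fun ε hε => ?_) (fun ε hε => ?_)
    · filter_upwards [h1 (2 * ε) (by positivity), hpos] with k hk hk0
      exact hge hk0 ((by ring : 2 * (l - ε) - 1 = 2 * l - 1 - 2 * ε) ▸ hk.1)
    · refine ((h3 (2 * ε) (by positivity)).and_eventually hpos).mono fun k hk => ?_
      exact hle hk.2 ((by ring : 2 * (l + ε) - 1 = 2 * l - 1 + 2 * ε) ▸ hk.1)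
  · refine limsup_eq_of_eventually_of_frequently (f.fractionCorrect_nonneg h)
      (f.fractionCorrect_le_one h) (fun ε hε => ?_) (fun ε hε => ?_)
    · filter_upwards [h1 (2 * ε) (by positivity), hpos] with k hk hk0
      exact hle hk0 ((by ring : 2 * (u + ε) - 1 = 2 * u - 1 + 2 * ε) ▸ hk.2)
    · refine ((h2 (2 * ε) (by positivity)).and_eventually hpos).mono fun k hk => ?_
      exact hge hk.2 ((by ring : 2 * (u - ε) - 1 = 2 * u - 1 - 2 * ε) ▸ hk.1)

end Strategy

/-! ### The excess of the parity strategy along a block -/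

/-- The sign of group `j` of block `n`. -/
noncomputable def sign (n j : ℕ) (h : ℕ → Bool) : ℝ :=
  if parity (group n j) h = true then 1 else -1

theorem sign_eq_one_or (n j : ℕ) (h : ℕ → Bool) : sign n j h = 1 ∨ sign n j h = -1 := by
  unfold sign; split_ifs <;> simp

theorem sign_eq_one_iff (n j : ℕ) (h : ℕ → Bool) :
    sign n j h = 1 ↔ parity (group n j) h = true := by
  unfold sign; split_ifs with H <;> simp [H]; norm_num

theorem excess_sub_excess (Φ : (ℕ → Bool) → ℝ × ℝ) {n j : ℕ} (hj : j ≤ rounds n) (h : ℕ → Bool)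
    {p : ℝ} (hp : stake Φ n j h = p) (hp0 : 0 ≤ p) (hp1 : p ≤ 1) {x y : ℕ}
    (hx : groupStart n j ≤ x) (hxy : x ≤ y) (hy : y ≤ groupStart n (j + 1)) :
    |(parityStrategy Φ).excess h y - (parityStrategy Φ).excess h x -
      sign n j h * (2 * p - 1) * (y - x)| ≤ 2 := by
  -- The bets telescope, so only the two fractional parts at `x` and `y` separate the change from
  -- exact slope.
  have key : (parityStrategy Φ).excess h y - (parityStrategy Φ).excess h x =
      sign n j h * (2 * (⌊(y : ℝ) * p⌋ - ⌊(x : ℝ) * p⌋) - (y - x)) := by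
    induction y, hxy using Nat.le_induction with
    | base => simp
    | succ y hxy ih =>
      have ih' := ih (by omega)
      have hmem : y ∈ group n j := Finset.mem_Ico.2 ⟨hx.trans hxy, by omega⟩
      have hstep : (parityStrategy Φ).excess h (y + 1) = (parityStrategy Φ).excess h y +
          (2 * (parityStrategy Φ).correct h y - 1) := by
        unfold Strategy.excess
        rw [Finset.sum_range_succ]
        push_cast
        ring
      have hc : 2 * (parityStrategy Φ).correct h y - 1 =
          sign n j h * (2 * (⌊((y + 1 : ℕ) : ℝ) * p⌋ - ⌊(y : ℝ) * p⌋) - 1) := by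
        rw [correct_parityStrategy Φ hj hmem h, hp, ← bet_eq hp0 hp1 y, sign]
        cases parity (group n j) h <;> cases bet y p <;> norm_num
      rw [hstep, hc]
      push_cast at ih' ⊢
      linear_combination ih'
  rw [key]
  have f1 := Int.floor_le ((y : ℝ) * p)
  have f2 := Int.lt_floor_add_one ((y : ℝ) * p)
  have f3 := Int.floor_le ((x : ℝ) * p)
  have f4 := Int.lt_floor_add_one ((x : ℝ) * p)
  rw [abs_le]
  rcases sign_eq_one_or n j h with hs | hs <;> rw [hs] <;> constructor <;> nlinarith

theorem stake_of_forall (Φ : (ℕ → Bool) → ℝ × ℝ) {n j : ℕ} {h : ℕ → Bool}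
    (H : ∀ i < j, sign n (i + 1) h = 1) :
    stake Φ n (j + 1) h =
      if Even n then (Φ fun m => h (blockStart m)).2 else (Φ fun m => h (blockStart m)).1 := by
  refine if_pos ⟨Nat.succ_ne_zero j, fun j' hj' => ?_⟩
  have hj' := Finset.mem_Ico.1 hj'
  have := H (j' - 1) (by omega)
  rwa [Nat.sub_add_cancel hj'.1, sign_eq_one_iff] at this

theorem stake_of_not_forall (Φ : (ℕ → Bool) → ℝ × ℝ) {n j : ℕ} {h : ℕ → Bool}
    (H : ¬ ∀ i < j, sign n (i + 1) h = 1) : stake Φ n (j + 1) h = 1 / 2 := by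
  refine if_neg fun hh => H fun i hi => ?_
  rw [sign_eq_one_iff]
  exact hh.2 (i + 1) (Finset.mem_Ico.2 ⟨by omega, by omega⟩)

theorem excess_neutral (Φ : (ℕ → Bool) → ℝ × ℝ) (n : ℕ) (h : ℕ → Bool) {k : ℕ}
    (hk : blockStart n ≤ k) (hk' : k ≤ blockStart n * (rounds n + 1)) :
    |(parityStrategy Φ).excess h k - (parityStrategy Φ).excess h (blockStart n)| ≤ 2 := by
  have hp : stake Φ n 0 h = 1 / 2 := if_neg fun hh => hh.1 rfl
  have := excess_sub_excess Φ (Nat.zero_le _) h hp (by norm_num) (by norm_num)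
    (le_refl (blockStart n)) hk (by simpa [groupStart] using hk')
  simpa using this

/-- The relative excess in the betting groups of one block. -/
theorem excess_block (Φ : (ℕ → Bool) → ℝ × ℝ) (h : ℕ → Bool) {l u : ℝ}
    (hΦ : (Φ fun m => h (blockStart m)) = (l, u))
    (hl : 0 ≤ l) (hl' : l ≤ 1 / 2) (hu : 1 / 2 ≤ u) (hu' : u ≤ 1) (n : ℕ) :
    (∀ k, blockStart n * (rounds n + 1) ≤ k → k ≤ blockStart (n + 1) →
      (2 * l - 1 - 21 / (rounds n + 1 : ℝ)) * k ≤ (parityStrategy Φ).excess h k ∧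
      (parityStrategy Φ).excess h k ≤ (2 * u - 1 + 21 / (rounds n + 1 : ℝ)) * k) ∧
    ((∀ j ∈ Finset.Icc 1 (rounds n), parity (group n j) h = true) →
      (Even n → (2 * u - 1 - 21 / (rounds n + 1 : ℝ)) * blockStart (n + 1) ≤
        (parityStrategy Φ).excess h (blockStart (n + 1))) ∧
      (¬ Even n → (parityStrategy Φ).excess h (blockStart (n + 1)) ≤
        (2 * l - 1 + 21 / (rounds n + 1 : ℝ)) * blockStart (n + 1))) := by
  set W := (parityStrategy Φ).excess h with hW
  have hT : |W (blockStart n)| ≤ blockStart n := (parityStrategy Φ).abs_excess_le h _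
  have h0 : |W (blockStart n * (rounds n + 1)) - W (blockStart n)| ≤ 2 :=
    excess_neutral Φ n h (Nat.le_mul_of_pos_right _ (by omega)) le_rfl
  have hs : ∀ j, sign n (j + 1) h = 1 ∨ sign n (j + 1) h = -1 := fun j => sign_eq_one_or _ _ _
  have hall : (∀ j ∈ Finset.Icc 1 (rounds n), parity (group n j) h = true) →
      ∀ i < rounds n, sign n (i + 1) h = 1 := fun H i hi =>
    (sign_eq_one_iff _ _ _).2 (H _ (Finset.mem_Icc.2 ⟨by omega, by omega⟩))
  have hlose : ∀ j < rounds n, (¬ ∀ i < j, sign n (i + 1) h = 1) → ∀ k,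
      blockStart n * (rounds n + 2 ^ j) ≤ k → k ≤ blockStart n * (rounds n + 2 ^ (j + 1)) →
      |W k - W (blockStart n * (rounds n + 2 ^ j))| ≤ 2 := by
    intro j hj H k hk hk'
    have := excess_sub_excess Φ (by omega : j + 1 ≤ rounds n) h (stake_of_not_forall Φ H)
      (by norm_num) (by norm_num) (le_refl (groupStart n (j + 1))) hk hk'
    simpa [groupStart] using this
  have hwin : ∀ p : ℝ, 0 ≤ p → p ≤ 1 → (if Even n then u else l) = p → ∀ j < rounds n,
      (∀ i < j, sign n (i + 1) h = 1) → ∀ k,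
      blockStart n * (rounds n + 2 ^ j) ≤ k → k ≤ blockStart n * (rounds n + 2 ^ (j + 1)) →
      |W k - W (blockStart n * (rounds n + 2 ^ j)) - sign n (j + 1) h * (2 * p - 1) *
        (k - blockStart n * (rounds n + 2 ^ j))| ≤ 2 := by
    intro p hp0 hp1 hp j hj H k hk hk'
    have hst := stake_of_forall Φ H
    rw [hΦ] at hst
    have := excess_sub_excess Φ (by omega : j + 1 ≤ rounds n) h (hst.trans hp)
      hp0 hp1 (le_refl (groupStart n (j + 1))) hk hk'
    simpa [groupStart] using this
  have hd : (0 : ℝ) ≤ 21 / (rounds n + 1 : ℝ) := by positivity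
  by_cases hn : Even n
  · obtain ⟨B, S⟩ := doubling_relative_bounds (W := W) (s := fun j => sign n (j + 1) h)
      (a := 2 * u - 1) (by linarith) (by linarith) hT
      (rounds_add_one_sq_le n) hs h0 (hwin u (by linarith) hu' (if_pos hn)) hlose
    refine ⟨fun k hk hk' => ?_, fun H => ⟨fun _ => S (hall H), fun hn' => absurd hn hn'⟩⟩
    obtain ⟨b1, b2⟩ := B k hk hk'
    refine ⟨le_trans ?_ b1, b2⟩
    nlinarith [(Nat.cast_nonneg k : (0 : ℝ) ≤ k)]
  -- Odd blocks gamble downwards: `-W` doubles with slope `1 - 2 * l`.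
  · obtain ⟨B, S⟩ := doubling_relative_bounds (W := fun k => -W k)
      (s := fun j => sign n (j + 1) h)
      (a := 1 - 2 * l) (by linarith) (by linarith) (by simpa using hT)
      (rounds_add_one_sq_le n) hs (by rw [← abs_neg]; convert h0 using 2; ring)
      (by
        intro j hj H k hk hk'
        have := hwin l hl (by linarith) (if_neg hn) j hj H k hk hk'
        rw [← abs_neg]
        convert this using 2
        ring)
      (by
        intro j hj H k hk hk'
        have := hlose j hj H k hk hk'
        rw [← abs_neg]
        convert this using 2
        ring)
    refine ⟨fun k hk hk' => ?_, fun H => ⟨fun hn' => absurd hn' hn, fun _ => ?_⟩⟩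
    · obtain ⟨b1, b2⟩ := B k hk hk'
      have hk0 := (Nat.cast_nonneg k : (0 : ℝ) ≤ k)
      constructor <;> nlinarith
    · have := S (hall H)
      change _ ≤ -W (blockStart (n + 1)) at this
      have e : ((blockStart n * (rounds n + 2 ^ rounds n) : ℕ) : ℝ) = blockStart (n + 1) := rfl
      rw [e] at this
      linarith

theorem tendsto_relative_error :
    Tendsto (fun n => 42 / (rounds n + 1 : ℝ)) atTop (nhds 0) := by
  have : Tendsto (fun n => (rounds n : ℝ) + 1) atTop atTop :=
    tendsto_atTop_add_const_right _ _ (tendsto_natCast_atTop_atTop.comp tendsto_rounds)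
  exact this.const_div_atTop 42

/-- `excess_block` says nothing about the neutral group. There the excess stays within `2` of its
value at the end of the previous block, so the error at most doubles, from `21` to `42`. -/
theorem excess_bounds (Φ : (ℕ → Bool) → ℝ × ℝ) (h : ℕ → Bool) {l u : ℝ}
    (hΦ : (Φ fun m => h (blockStart m)) = (l, u))
    (hl : 0 ≤ l) (hl' : l ≤ 1 / 2) (hu : 1 / 2 ≤ u) (hu' : u ≤ 1) {n k : ℕ}
    (hk : blockStart (n + 1) ≤ k) (hk' : k ≤ blockStart (n + 2)) :
    (2 * l - 1 - 42 / (rounds n + 1 : ℝ)) * k ≤ (parityStrategy Φ).excess h k ∧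
      (parityStrategy Φ).excess h k ≤ (2 * u - 1 + 42 / (rounds n + 1 : ℝ)) * k := by
  set W := (parityStrategy Φ).excess h with hW
  have hblock := excess_block Φ h hΦ hl hl' hu hu'
  have hKpos : (0 : ℝ) < rounds n + 1 := by positivity
  have hmono : 21 / (rounds (n + 1) + 1 : ℝ) ≤ 21 / (rounds n + 1 : ℝ) := by
    have : (rounds n : ℝ) ≤ rounds (n + 1) := by exact_mod_cast rounds_mono (Nat.le_succ n)
    gcongr
  have he : 42 / (rounds n + 1 : ℝ) = 21 / (rounds n + 1 : ℝ) + 21 / (rounds n + 1 : ℝ) := by ring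
  have hd : (0 : ℝ) ≤ 21 / (rounds n + 1 : ℝ) := by positivity
  have hk0 : (0 : ℝ) ≤ k := Nat.cast_nonneg k
  rw [he]
  rcases le_total k (blockStart (n + 1) * (rounds (n + 1) + 1)) with hR | hR
  · have hN := excess_neutral Φ (n + 1) h hk hR
    rw [← hW, abs_le] at hN
    have hle : blockStart n * (rounds n + 1) ≤ blockStart (n + 1) := by
      have : 1 ≤ 2 ^ rounds n := Nat.one_le_two_pow
      exact Nat.mul_le_mul_left _ (by omega)
    obtain ⟨b1, b2⟩ := (hblock n).1 _ hle le_rfl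
    rw [← hW] at b1 b2
    have hTk : (blockStart (n + 1) : ℝ) ≤ k := by exact_mod_cast hk
    have hT0 : (0 : ℝ) ≤ blockStart (n + 1) := Nat.cast_nonneg _
    have hsq : (rounds n + 1 : ℝ) ^ 2 ≤ 4 * blockStart (n + 1) := by
      have h1 : ((rounds n + 1) ^ 2 : ℕ) ≤ 4 * blockStart (n + 1) := by
        have := rounds_add_one_sq_le n
        have := blockStart_strictMono.monotone (Nat.le_add_right n 1)
        omega
      exact_mod_cast h1
    have h2 : (2 : ℝ) ≤ 21 / (rounds n + 1 : ℝ) * k := by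
      rw [div_mul_eq_mul_div, le_div_iff₀ hKpos]
      have : (1 : ℝ) ≤ rounds n + 1 := by linarith [(Nat.cast_nonneg (rounds n) : (0 : ℝ) ≤ _)]
      nlinarith
    have q1 : (1 - 2 * l + 21 / (rounds n + 1 : ℝ)) * blockStart (n + 1) ≤
        (1 - 2 * l + 21 / (rounds n + 1 : ℝ)) * k :=
      mul_le_mul_of_nonneg_left hTk (by linarith)
    have q2 : (2 * u - 1 + 21 / (rounds n + 1 : ℝ)) * blockStart (n + 1) ≤
        (2 * u - 1 + 21 / (rounds n + 1 : ℝ)) * k :=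
      mul_le_mul_of_nonneg_left hTk (by linarith)
    constructor <;> linarith
  · obtain ⟨b1, b2⟩ := (hblock (n + 1)).1 k hR hk'
    rw [← hW] at b1 b2
    have q := mul_le_mul_of_nonneg_right hmono hk0
    have q' := mul_nonneg hd hk0
    constructor <;> linarith

theorem densities_parityStrategy (Φ : (ℕ → Bool) → ℝ × ℝ) (h : ℕ → Bool) {l u : ℝ}
    (hΦ : (Φ fun m => h (blockStart m)) = (l, u))
    (hl : 0 ≤ l) (hl' : l ≤ 1 / 2) (hu : 1 / 2 ≤ u) (hu' : u ≤ 1)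
    (heven : ∃ᶠ n in atTop, ∀ j ∈ Finset.Icc 1 (rounds (2 * n)), parity (group (2 * n) j) h = true)
    (hodd : ∃ᶠ n in atTop, ∀ j ∈ Finset.Icc 1 (rounds (2 * n + 1)),
      parity (group (2 * n + 1) j) h = true) :
    (parityStrategy Φ).lowerDensity h = l ∧ (parityStrategy Φ).upperDensity h = u := by
  have hblock := excess_block Φ h hΦ hl hl' hu hu'
  have hsmall : ∀ ε > 0, ∀ᶠ n in atTop, 42 / (rounds n + 1 : ℝ) < ε := fun ε hε =>
    tendsto_relative_error.eventually_lt_const hε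
  have hhalf : ∀ n, 21 / (rounds n + 1 : ℝ) ≤ 42 / (rounds n + 1 : ℝ) := fun n => by
    gcongr; norm_num
  have hT : Tendsto blockStart atTop atTop := blockStart_strictMono.tendsto_atTop
  apply Strategy.densities_eq
  · intro ε hε
    obtain ⟨N, hN⟩ := eventually_atTop.1 (hsmall ε hε)
    filter_upwards [eventually_ge_atTop (blockStart (N + 1))] with k hk
    obtain ⟨m, hm, hm1, hm2⟩ := exists_blockStart_le hk
    obtain ⟨n, rfl⟩ : ∃ n, m = n + 1 := ⟨m - 1, by omega⟩
    obtain ⟨b1, b2⟩ := excess_bounds Φ h hΦ hl hl' hu hu' hm1 hm2.le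
    have hn := (hN n (by omega)).le
    have hk0 : (0 : ℝ) ≤ k := Nat.cast_nonneg k
    exact ⟨(mul_le_mul_of_nonneg_right (by linarith) hk0).trans b1,
      b2.trans (mul_le_mul_of_nonneg_right (by linarith) hk0)⟩
  · intro ε hε
    have ht : Tendsto (fun n : ℕ => 2 * n) atTop atTop :=
      tendsto_atTop_mono (fun n => by simp only [id]; omega) tendsto_id
    have ht' : Tendsto (fun n => blockStart (2 * n + 1)) atTop atTop :=
      hT.comp (tendsto_atTop_mono (fun n => Nat.le_succ (2 * n)) ht)
    refine ht'.frequently ((heven.and_eventually (ht.eventually (hsmall ε hε))).mono ?_)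
    rintro n ⟨H, hn⟩
    have := ((hblock (2 * n)).2 H).1 (even_two_mul n)
    refine (mul_le_mul_of_nonneg_right ?_ (Nat.cast_nonneg _)).trans this
    linarith [hhalf (2 * n)]
  · intro ε hε
    have ht : Tendsto (fun n : ℕ => 2 * n + 1) atTop atTop :=
      tendsto_atTop_mono (fun n => by simp only [id]; omega) tendsto_id
    have ht' : Tendsto (fun n => blockStart (2 * n + 1 + 1)) atTop atTop :=
      hT.comp (tendsto_atTop_mono (fun n => Nat.le_succ (2 * n + 1)) ht)
    refine ht'.frequently ((hodd.and_eventually (ht.eventually (hsmall ε hε))).mono ?_)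
    rintro n ⟨H, hn⟩
    have := ((hblock (2 * n + 1)).2 H).2 (by simp)
    refine this.trans (mul_le_mul_of_nonneg_right ?_ (Nat.cast_nonneg _))
    linarith [hhalf (2 * n + 1)]

/-! ### Almost sure wins and the law of the densities -/

theorem ae_frequently_win (g : ℕ → ℕ) (hg : Function.Injective g) (hg' : ∀ n, g n ≤ 2 * n + 1) :
    ∀ᵐ h ∂coinMeasure ℕ, ∃ᶠ n in atTop,
      ∀ j ∈ Finset.Icc 1 (rounds (g n)), parity (group (g n) j) h = true := by
  refine ae_frequently_forall_parity (fun n => rounds (g n)) (fun n => group (g n)) ?_ ?_ ?_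
  · intro n j _
    exact Finset.nonempty_Ico.2 (groupStart_strictMono _ (Nat.lt_succ_self j))
  · intro n n' j j' hj hj' hne
    refine disjoint_group (Finset.mem_Icc.1 hj).2 (Finset.mem_Icc.1 hj').2 fun e => hne ?_
    simp only [Prod.mk.injEq] at e ⊢
    exact ⟨hg e.1, e.2⟩
  · exact tsum_two_inv_pow_eq_top fun n => (two_pow_rounds_le _).trans (by have := hg' n; omega)

theorem IsFairHats.map_eq {Ω : Type*} [MeasurableSpace Ω] {P : Measure Ω} {ξ : ℕ → Ω → Bool}
    (hξ : IsFairHats ξ P) : P.map (fun ω i => ξ i ω) = coinMeasure ℕ := by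
  rw [hξ.indep.map_fun_eq_infinitePi_map hξ.measurable, coinMeasure]
  simp_rw [hξ.law]

theorem exists_strategy_hasLaw (μ : Measure (ℝ × ℝ)) [IsProbabilityMeasure μ]
    (hμ : μ (Set.Icc (0 : ℝ) (1 / 2) ×ˢ Set.Icc (1 / 2 : ℝ) 1) = 1) :
    ∃ f : Strategy, f.IsMeasurable ∧
      ∀ (Ω : Type*) [MeasurableSpace Ω] (P : Measure Ω) [IsProbabilityMeasure P]
        (ξ : ℕ → Ω → Bool), IsFairHats ξ P →
        HasLaw (fun ω => (f.lowerDensity (fun i => ξ i ω), f.upperDensity (fun i => ξ i ω)))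
          μ P := by
  obtain ⟨Φ, hΦ, hΦμ⟩ := exists_measurable_map_coinMeasure μ
  refine ⟨parityStrategy Φ, isMeasurable_parityStrategy hΦ, ?_⟩
  intro Ω _ P _ ξ hξ
  have hm : Measurable fun ω i => ξ i ω := measurable_pi_lambda _ hξ.measurable
  have hr : Measurable fun (h : ℕ → Bool) (m : ℕ) => h (blockStart m) := by fun_prop
  -- The hats at the block starts are again a sequence of fair coins.
  have hmap : (coinMeasure ℕ).map (fun h => Φ fun m => h (blockStart m)) = μ := by
    rw [← hΦμ, ← coinMeasure_map_of_injective blockStart_strictMono.injective,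
      Measure.map_map hΦ hr, coinMeasure_map_of_injective blockStart_strictMono.injective]
    rfl
  have hrect : MeasurableSet (Set.Icc (0 : ℝ) (1 / 2) ×ˢ Set.Icc (1 / 2 : ℝ) 1) :=
    measurableSet_Icc.prod measurableSet_Icc
  have hae : ∀ᵐ h ∂coinMeasure ℕ, (Φ fun m => h (blockStart m)) ∈
      Set.Icc (0 : ℝ) (1 / 2) ×ˢ Set.Icc (1 / 2 : ℝ) 1 := by
    refine ae_of_ae_map (hΦ.comp hr).aemeasurable (p := fun q => q ∈ _) ?_
    rw [show (coinMeasure ℕ).map (Φ ∘ fun h m => h (blockStart m)) = μ from hmap]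
    exact (mem_ae_iff_prob_eq_one hrect).2 hμ
  have hmain : ∀ᵐ h ∂coinMeasure ℕ,
      ((parityStrategy Φ).lowerDensity h, (parityStrategy Φ).upperDensity h) =
        Φ fun m => h (blockStart m) := by
    filter_upwards [hae, ae_frequently_win (fun n => 2 * n) (fun a b e => by simpa using e)
      (fun n => by omega), ae_frequently_win (fun n => 2 * n + 1) (fun a b e => by simpa using e)
      (fun n => by omega)] with h h1 h2 h3
    obtain ⟨⟨a1, a2⟩, a3, a4⟩ := h1
    obtain ⟨e1, e2⟩ := densities_parityStrategy Φ h rfl a1 a2 a3 a4 h2 h3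
    exact Prod.ext e1 e2
  rw [← hξ.map_eq] at hmain hmap
  have hmain' := ae_of_ae_map hm.aemeasurable hmain
  have hlaw : HasLaw (fun ω => Φ fun m => ξ (blockStart m) ω) μ P := by
    refine ⟨((hΦ.comp hr).comp hm).aemeasurable, ?_⟩
    rw [← hmap]
    exact (Measure.map_map (hΦ.comp hr) hm).symm
  exact hlaw.congr hmain'

end HatGame

theorem mainTheorem4 :
    (∀ l u : ℝ, 0 ≤ l → l ≤ 1 / 2 → 1 / 2 ≤ u → u ≤ 1 →
      ∃ f : HatGame.Strategy, f.IsMeasurable ∧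
        ∀ (Ω : Type*) [MeasurableSpace Ω] (P : Measure Ω) [IsProbabilityMeasure P]
          (ξ : ℕ → Ω → Bool), HatGame.IsFairHats ξ P →
          ∀ᵐ ω ∂P, f.lowerDensity (fun i => ξ i ω) = l ∧ f.upperDensity (fun i => ξ i ω) = u) ∧
    (∀ (μ : Measure (ℝ × ℝ)) [IsProbabilityMeasure μ],
      μ (Set.Icc (0 : ℝ) (1 / 2) ×ˢ Set.Icc (1 / 2 : ℝ) 1) = 1 →
      ∃ f : HatGame.Strategy, f.IsMeasurable ∧
        ∀ (Ω : Type*) [MeasurableSpace Ω] (P : Measure Ω) [IsProbabilityMeasure P]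
          (ξ : ℕ → Ω → Bool), HatGame.IsFairHats ξ P →
          HasLaw (fun ω => (f.lowerDensity (fun i => ξ i ω), f.upperDensity (fun i => ξ i ω)))
            μ P) := by

  refine ⟨fun l u hl hl' hu hu' => ?_, fun μ _ hμ => HatGame.exists_strategy_hasLaw μ hμ⟩
  obtain ⟨f, hf, hlaw⟩ := HatGame.exists_strategy_hasLaw (Measure.dirac (l, u)) (by
    rw [Measure.dirac_apply' _ (measurableSet_Icc.prod measurableSet_Icc)]
    refine Set.indicator_of_mem ?_ _
    exact ⟨⟨hl, hl'⟩, hu, hu'⟩)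
  refine ⟨f, hf, fun Ω _ P _ ξ hξ => ?_⟩
  have h := hlaw Ω P ξ hξ
  have hae : ∀ᵐ q ∂P.map (fun ω => (f.lowerDensity (fun i => ξ i ω),
      f.upperDensity (fun i => ξ i ω))), q = (l, u) := by
    rw [h.map_eq, ae_dirac_eq]
    exact rfl
  filter_upwards [ae_of_ae_map h.aemeasurable hae] with ω hω
  exact Prod.ext_iff.1 hω
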